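/- **Theorem 4.8.** Let $k$ be an algebraically closed field of characteristic zero, and let $H$ be a Hopf algebra over $k$ with antipode $S$ which is semisimple (as a ring). A Hopf subalgebra $A\subseteq H$ is *normal* if $h_1AS(h_2)\subseteq A$ and $S(h_1)Ah_2\subseteq A$ for all $h\in H$ (where $\Delta(h)=h_1\otimes h_2$), and a *direct factor* of $H$ if it is normal and there is a normal Hopf subalgebra $L$ of $H$ such that multiplication $A\otimes L\to H$, $a\otimes l\mapsto al$, is an isomorphism of Hopf algebras. A Hopf algebra is *simple* if it is not equal to $k$ and its only normal Hopf subalgebras are $k$ and itself. Suppose that every proper normal Hopf subalgebra $N\neq H$ of $H$ is contained in a proper direct factor $A\neq H$ of $H$. Then $H$ is *completely reducible*: there is a family $(K_\lambda)_{\lambda\in\Lambda}$ of normal Hopf subalgebras of $H$, each of which is a simple and semisimple Hopf algebra, such that $H$ is the internal tensor product of the $K_\lambda$, that is, $H$ is generated by the $K_\lambda$, and for every $\mu\in\Lambda$ the intersection of $K_\mu$ with the Hopf subalgebra generated by all $K_\lambda$ with $\lambda\neq\mu$ is $k$. -/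

import Mathlib

open scoped TensorProduct

universe v

/-- A Hopf subalgebra of a Hopf algebra `H` over a field `k`: a subalgebra `K` with
`Δ(K) ⊆ K ⊗ K` (the image of `K ⊗ K` in `H ⊗ H`) and `S(K) ⊆ K`. -/
structure HopfSubalgebra (k : Type*) (H : Type*) [Field k] [Ring H] [HopfAlgebra k H]
    extends Subalgebra k H where
  comul_mem' : ∀ x ∈ toSubalgebra, Coalgebra.comul (R := k) x ∈
    (Algebra.TensorProduct.map toSubalgebra.val toSubalgebra.val).range
  antipode_mem' : ∀ x ∈ toSubalgebra, HopfAlgebra.antipode k x ∈ toSubalgebra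

namespace HopfSubalgebra

section HopfStructure

variable {k : Type*} {H : Type*} [Field k] [Ring H] [HopfAlgebra k H] (K : HopfSubalgebra k H)

theorem map_val_injective :
    Function.Injective (Algebra.TensorProduct.map K.toSubalgebra.val K.toSubalgebra.val) :=
  TensorProduct.map_injective_of_flat_flat K.toSubalgebra.val.toLinearMap
    K.toSubalgebra.val.toLinearMap Subtype.val_injective Subtype.val_injective

/-- The restriction `K → K ⊗ K` of the comultiplication of `H`. -/
noncomputable def comulRestrict : K.toSubalgebra →ₐ[k] K.toSubalgebra ⊗[k] K.toSubalgebra :=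
  (AlgEquiv.ofInjective _ K.map_val_injective).symm.toAlgHom.comp
    (((Bialgebra.comulAlgHom k H).comp K.toSubalgebra.val).codRestrict _
      (fun x => K.comul_mem' x x.2))

theorem map_val_comulRestrict (x : K.toSubalgebra) :
    Algebra.TensorProduct.map K.toSubalgebra.val K.toSubalgebra.val (K.comulRestrict x) =
      Coalgebra.comul (R := k) (x : H) :=
  congrArg Subtype.val ((AlgEquiv.ofInjective _ K.map_val_injective).apply_symm_apply
    ((((Bialgebra.comulAlgHom k H).comp K.toSubalgebra.val).codRestrict _
      (fun x => K.comul_mem' x x.2)) x))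

theorem map_val_comp_comulRestrict :
    TensorProduct.map K.toSubalgebra.val.toLinearMap K.toSubalgebra.val.toLinearMap ∘ₗ
      K.comulRestrict.toLinearMap =
      Coalgebra.comul (R := k) ∘ₗ K.toSubalgebra.val.toLinearMap :=
  LinearMap.ext K.map_val_comulRestrict

/-- A Hopf subalgebra is a coalgebra under the restricted structure maps. -/
noncomputable instance instCoalgebra : Coalgebra k K.toSubalgebra where
  comul := K.comulRestrict.toLinearMap
  counit := Coalgebra.counit (R := k) ∘ₗ K.toSubalgebra.val.toLinearMap
  coassoc := by
    set i := K.toSubalgebra.val.toLinearMap with hi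
    have hinj : Function.Injective i := Subtype.val_injective
    have h2 := K.map_val_comp_comulRestrict
    rw [← hi] at h2
    set D := K.comulRestrict.toLinearMap
    have hinj3 : Function.Injective (TensorProduct.map i (TensorProduct.map i i)) :=
      TensorProduct.map_injective_of_flat_flat _ _ hinj K.map_val_injective
    rw [← LinearMap.cancel_left hinj3]
    have e1 : TensorProduct.map i (TensorProduct.map i i) ∘ₗ
        (TensorProduct.assoc k _ _ _).toLinearMap ∘ₗ D.rTensor _ ∘ₗ D =
        (TensorProduct.assoc k H H H).toLinearMap ∘ₗ
          (Coalgebra.comul (R := k) (A := H)).rTensor H ∘ₗ Coalgebra.comul (R := k) ∘ₗ i := by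
      have a : TensorProduct.map i (TensorProduct.map i i) ∘ₗ
          (TensorProduct.assoc k _ _ _).toLinearMap =
          (TensorProduct.assoc k H H H).toLinearMap ∘ₗ
            TensorProduct.map (TensorProduct.map i i) i := by
        ext x y z; rfl
      have b : TensorProduct.map (TensorProduct.map i i) i ∘ₗ D.rTensor _ =
          (Coalgebra.comul (R := k) (A := H)).rTensor H ∘ₗ TensorProduct.map i i := by
        ext x y
        exact congrArg (fun t => t ⊗ₜ[k] (y : H)) (LinearMap.congr_fun h2 x)
      rw [← h2, ← LinearMap.comp_assoc, a, LinearMap.comp_assoc, ← LinearMap.comp_assoc D, b,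
        LinearMap.comp_assoc]
    have e2 : TensorProduct.map i (TensorProduct.map i i) ∘ₗ D.lTensor _ ∘ₗ D =
        (Coalgebra.comul (R := k) (A := H)).lTensor H ∘ₗ Coalgebra.comul (R := k) ∘ₗ i := by
      rw [← h2, ← LinearMap.comp_assoc, ← LinearMap.comp_assoc]
      congr 1
      ext x y
      exact congrArg (fun t => (x : H) ⊗ₜ[k] t) (LinearMap.congr_fun h2 y)
    rw [e1, e2]
    ext x
    exact Coalgebra.coassoc_apply (R := k) (x : H)
  rTensor_counit_comp_comul := by
    have h2 := K.map_val_comulRestrict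
    ext x
    have hinj : Function.Injective (K.toSubalgebra.val.toLinearMap.lTensor k) :=
      Module.Flat.lTensor_preserves_injective_linearMap _ Subtype.val_injective
    apply hinj
    have h := Coalgebra.rTensor_counit_comul (R := k) (x : H)
    rw [← h2] at h
    refine Eq.trans ?_ h
    change (LinearMap.lTensor k K.toSubalgebra.val.toLinearMap ∘ₗ
        LinearMap.rTensor K.toSubalgebra
          (Coalgebra.counit (R := k) ∘ₗ K.toSubalgebra.val.toLinearMap)) (K.comulRestrict x) =
      (LinearMap.rTensor H (Coalgebra.counit (R := k)) ∘ₗ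
        TensorProduct.map K.toSubalgebra.val.toLinearMap K.toSubalgebra.val.toLinearMap)
        (K.comulRestrict x)
    congr 1
    ext y z
    rfl
  lTensor_counit_comp_comul := by
    have h2 := K.map_val_comulRestrict
    ext x
    have hinj : Function.Injective (K.toSubalgebra.val.toLinearMap.rTensor k) :=
      Module.Flat.rTensor_preserves_injective_linearMap _ Subtype.val_injective
    apply hinj
    have h := Coalgebra.lTensor_counit_comul (R := k) (x : H)
    rw [← h2] at h
    refine Eq.trans ?_ h
    change (LinearMap.rTensor k K.toSubalgebra.val.toLinearMap ∘ₗ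
        LinearMap.lTensor K.toSubalgebra
          (Coalgebra.counit (R := k) ∘ₗ K.toSubalgebra.val.toLinearMap)) (K.comulRestrict x) =
      (LinearMap.lTensor H (Coalgebra.counit (R := k)) ∘ₗ
        TensorProduct.map K.toSubalgebra.val.toLinearMap K.toSubalgebra.val.toLinearMap)
        (K.comulRestrict x)
    congr 1
    ext y z
    rfl

noncomputable instance instBialgebra : Bialgebra k K.toSubalgebra :=
  Bialgebra.mk' k K.toSubalgebra (Bialgebra.counit_one (R := k) (A := H))
    (fun {a b} => Bialgebra.counit_mul (R := k) (a : H) (b : H))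
    (map_one K.comulRestrict) (fun {a b} => map_mul K.comulRestrict a b)

/-- The restriction `K → K` of the antipode of `H`. -/
def antipodeRestrict : K.toSubalgebra →ₗ[k] K.toSubalgebra where
  toFun x := ⟨HopfAlgebra.antipode k (x : H), K.antipode_mem' x x.2⟩
  map_add' x y := Subtype.ext (map_add _ (x : H) (y : H))
  map_smul' c x := Subtype.ext (map_smul (HopfAlgebra.antipode k (A := H)) c (x : H))

/-- A Hopf subalgebra is itself a Hopf algebra, with the restricted structure maps. -/
noncomputable instance instHopfAlgebra : HopfAlgebra k K.toSubalgebra where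
  antipode := K.antipodeRestrict
  mul_antipode_rTensor_comul := by
    ext x
    have h := HopfAlgebra.mul_antipode_rTensor_comul_apply (R := k) (x : H)
    rw [← K.map_val_comulRestrict] at h
    refine Eq.trans ?_ h
    change (K.toSubalgebra.val.toLinearMap ∘ₗ LinearMap.mul' k K.toSubalgebra ∘ₗ
        LinearMap.rTensor K.toSubalgebra K.antipodeRestrict) (K.comulRestrict x) =
      (LinearMap.mul' k H ∘ₗ LinearMap.rTensor H (HopfAlgebra.antipode k) ∘ₗ
        TensorProduct.map K.toSubalgebra.val.toLinearMap K.toSubalgebra.val.toLinearMap)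
        (K.comulRestrict x)
    congr 1
    ext y z
    rfl
  mul_antipode_lTensor_comul := by
    ext x
    have h := HopfAlgebra.mul_antipode_lTensor_comul_apply (R := k) (x : H)
    rw [← K.map_val_comulRestrict] at h
    refine Eq.trans ?_ h
    change (K.toSubalgebra.val.toLinearMap ∘ₗ LinearMap.mul' k K.toSubalgebra ∘ₗ
        LinearMap.lTensor K.toSubalgebra K.antipodeRestrict) (K.comulRestrict x) =
      (LinearMap.mul' k H ∘ₗ LinearMap.lTensor H (HopfAlgebra.antipode k) ∘ₗ
        TensorProduct.map K.toSubalgebra.val.toLinearMap K.toSubalgebra.val.toLinearMap)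
        (K.comulRestrict x)
    congr 1
    ext y z
    rfl

end HopfStructure

section Generated

variable {k : Type*} {H : Type*} [Field k] [Ring H] [HopfAlgebra k H]

/-- The Hopf subalgebra `⟨K i | i ∈ ι⟩` of `H` generated by a family of Hopf subalgebras; its
underlying algebra is the subalgebra generated by the family. -/
def generated {ι : Type*} (K : ι → HopfSubalgebra k H) : HopfSubalgebra k H where
  toSubalgebra := ⨆ i, (K i).toSubalgebra
  comul_mem' := by
    set A : Subalgebra k H := ⨆ i, (K i).toSubalgebra
    have h : A ≤ (Algebra.TensorProduct.map A.val A.val).range.comap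
        (Bialgebra.comulAlgHom k H) := by
      refine iSup_le fun i x hx => ?_
      obtain ⟨t, ht⟩ := (K i).comul_mem' x hx
      have hi : (K i).toSubalgebra ≤ A := le_iSup (fun j => (K j).toSubalgebra) i
      refine ⟨Algebra.TensorProduct.map (Subalgebra.inclusion hi) (Subalgebra.inclusion hi) t, ?_⟩
      refine Eq.trans ?_ ht
      change ((Algebra.TensorProduct.map A.val A.val).comp (Algebra.TensorProduct.map
        (Subalgebra.inclusion hi) (Subalgebra.inclusion hi))) t = _
      rw [← Algebra.TensorProduct.map_comp]
      rfl
    exact h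
  antipode_mem' := by
    intro x hx
    refine Algebra.iSup_induction (fun i => (K i).toSubalgebra)
      (motive := fun y => HopfAlgebra.antipode k y ∈ ⨆ i, (K i).toSubalgebra) hx ?_ ?_ ?_ ?_
    · exact fun i a ha => Algebra.mem_iSup_of_mem i ((K i).antipode_mem' a ha)
    · intro a b ha hb
      rw [map_add]
      exact add_mem ha hb
    · intro a b ha hb
      rw [HopfAlgebra.antipode_mul_antidistrib]
      exact mul_mem hb ha
    · intro r
      rw [Algebra.algebraMap_eq_smul_one, map_smul, HopfAlgebra.antipode_one]
      exact Subalgebra.smul_mem _ (one_mem _) r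

theorem le_generated {ι : Type*} (K : ι → HopfSubalgebra k H) (i : ι) :
    (K i).toSubalgebra ≤ (generated K).toSubalgebra :=
  le_iSup (fun j => (K j).toSubalgebra) i

theorem generated_le {ι : Type*} (K : ι → HopfSubalgebra k H) (L : HopfSubalgebra k H)
    (h : ∀ i, (K i).toSubalgebra ≤ L.toSubalgebra) :
    (generated K).toSubalgebra ≤ L.toSubalgebra :=
  iSup_le h

end Generated

section Predicates

variable (k : Type*) {H : Type*} [Field k] [Ring H] [HopfAlgebra k H]

/-- The linear map `h ↦ h₁ a S(h₂)` on `H`, in Sweedler notation `Δ(h) = h₁ ⊗ h₂`. -/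
noncomputable def leftAdjoint (a : H) : H →ₗ[k] H :=
  LinearMap.mul' k H ∘ₗ
    TensorProduct.map (LinearMap.mulRight k a) (HopfAlgebra.antipode k) ∘ₗ Coalgebra.comul

/-- The linear map `h ↦ S(h₁) a h₂` on `H`, in Sweedler notation `Δ(h) = h₁ ⊗ h₂`. -/
noncomputable def rightAdjoint (a : H) : H →ₗ[k] H :=
  LinearMap.mul' k H ∘ₗ
    TensorProduct.map (HopfAlgebra.antipode k) (LinearMap.mulLeft k a) ∘ₗ Coalgebra.comul

variable {k}

/-- `A` is normal in `H`: `h₁ A S(h₂) ⊆ A` and `S(h₁) A h₂ ⊆ A` for all `h ∈ H`. -/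
def IsNormal (A : HopfSubalgebra k H) : Prop :=
  ∀ h : H, ∀ a ∈ A.toSubalgebra,
    leftAdjoint k a h ∈ A.toSubalgebra ∧ rightAdjoint k a h ∈ A.toSubalgebra

/-- `H` is the tensor product of its Hopf subalgebras `A` and `L`: the multiplication map
`A ⊗ L → H`, `a ⊗ l ↦ a l`, is an isomorphism of Hopf algebras. -/
def IsTensorFactorization (A L : HopfSubalgebra k H) : Prop :=
  ∃ e : A.toSubalgebra ⊗[k] L.toSubalgebra ≃ₐc[k] H,
    ∀ (a : A.toSubalgebra) (l : L.toSubalgebra), e (a ⊗ₜ[k] l) = (a : H) * (l : H)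

/-- `A` is a direct factor of `H`: it is normal and has a normal complement `L`, so that
`H` is the tensor product of `A` and `L`. -/
def IsDirectFactor (A : HopfSubalgebra k H) : Prop :=
  A.IsNormal ∧ ∃ L : HopfSubalgebra k H, L.IsNormal ∧ IsTensorFactorization A L

/-- `H` is the internal tensor product of a family of normal Hopf subalgebras: the family
generates `H`, and each member meets the Hopf subalgebra generated by the others in `k`. -/
def IsInternalTensorProduct {ι : Type*} (K : ι → HopfSubalgebra k H) : Prop :=
  (∀ i, (K i).IsNormal) ∧ (generated K).toSubalgebra = ⊤ ∧
    ∀ i, (K i).toSubalgebra ⊓ (generated fun j : {j : ι // j ≠ i} => K j).toSubalgebra = ⊥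

end Predicates

end HopfSubalgebra

/-- A Hopf algebra `H` over `k` is simple if it is not `k` itself and its only normal Hopf
subalgebras are `k` and `H`. -/
def IsSimpleHopf (k H : Type*) [Field k] [Ring H] [HopfAlgebra k H] : Prop :=
  (⊥ : Subalgebra k H) ≠ ⊤ ∧
    ∀ N : HopfSubalgebra k H, N.IsNormal → N.toSubalgebra = ⊥ ∨ N.toSubalgebra = ⊤

/-- `H` is completely reducible: it is the internal tensor product of a family of simple
semisimple Hopf algebras. The members of such a family are pairwise distinct subsets of `H`,
so indexing by types in the universe of `H` is no restriction. -/
def IsCompletelyReducibleHopf (k : Type*) (H : Type v) [Field k] [Ring H] [HopfAlgebra k H] :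
    Prop :=
  ∃ (ι : Type v) (K : ι → HopfSubalgebra k H), HopfSubalgebra.IsInternalTensorProduct K ∧
    ∀ i, IsSimpleHopf k (K i).toSubalgebra ∧ IsSemisimpleRing (K i).toSubalgebra

/-! Simple factors are split off one at a time, and the process stops because a semisimple Hopf
algebra is finite-dimensional (its normalized integral forces this).

A tensor factor `A` of `H` is encoded by an idempotent Hopf endomorphism `π` with image `A`, trivial
on a complement `L`, with `π = id * θ` (convolution) for some `θ` valued in `L`. Any homomorphism
trivial on `L` then factors through `π`. Moreover `H` acts on `A` by the adjoint actions through
`π`, so normality passes from Hopf subalgebras of `A` to `H`.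

Given `A ≠ k`, take `N` maximal among the normal Hopf subalgebras of `H` properly inside `A`.
Applying `π` shows `NL ≠ H`, so the hypothesis yields `H = B ⊗ C` with `NL ⊆ B ≠ H`. Let `β`, `γ` be
the projections to `B`, `C`, and put `σ = πβ`, `κ = πγ`. Maximality gives `σ(H) = N`, the identity
`π = σ * κ` shows that `A` is generated by `N` and `κ(H)`, and maximality again makes `κ(H)` simple
(`exists_splitting`, `isSimpleHopf_range`). Since `σ` projects onto `N` along the join of `κ(H)` and
`L`, induction on dimension continues with `N` (`exists_family`). -/

section CompleteReducibility

open WithConv Coalgebra HopfAlgebra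

/-! ### Homomorphisms and antipodes -/

namespace BialgHom

variable {k C D : Type*} [Field k] [Ring C] [HopfAlgebra k C] [Ring D] [HopfAlgebra k D]

/-- A bialgebra homomorphism between Hopf algebras commutes with the antipodes. -/
theorem map_antipode (f : C →ₐc[k] D) (x : C) : f (antipode k x) = antipode k (f x) := by
  -- `f ∘ S` is a left and `S ∘ f` a right convolution inverse of `f`, so the two agree.
  have h1 : toConv ((f : C →ₐ[k] D).toLinearMap ∘ₗ antipode k) *
      toConv (f : C →ₐ[k] D).toLinearMap = 1 := by
    have h := LinearMap.algHom_comp_convMul_distrib (f : C →ₐ[k] D) (toConv (antipode k (A := C)))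
      (toConv LinearMap.id)
    rw [LinearMap.antipode_mul_id] at h
    apply WithConv.ext
    refine h.symm.trans ?_
    ext x
    exact (AlgHomClass.commutes f _)
  have h2 : toConv (f : C →ₐ[k] D).toLinearMap *
      toConv (antipode k ∘ₗ (f : C →ₐ[k] D).toLinearMap) = 1 := by
    have h := LinearMap.convMul_comp_coalgHom_distrib (toConv LinearMap.id)
      (toConv (antipode k (A := D))) (f : C →ₗc[k] D)
    rw [LinearMap.id_mul_antipode] at h
    apply WithConv.ext
    refine h.symm.trans ?_
    ext x
    simp
  exact LinearMap.congr_fun (congrArg ofConv (left_inv_eq_right_inv h1 h2)) x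

end BialgHom

namespace HopfSubalgebra

/-! ### Adjoint actions, convolution, and normality of joins -/

section Adjoint

variable {k H : Type*} [Field k] [Ring H] [HopfAlgebra k H]

theorem leftAdjoint_eq_sum (a : H) {h : H} {ι : Type*} (r : Coalgebra.Repr k h ι) :
    leftAdjoint k a h = ∑ i ∈ r.index, r.left i * a * antipode k (r.right i) := by
  simp [leftAdjoint, ← r.eq]

theorem rightAdjoint_eq_sum (a : H) {h : H} {ι : Type*} (r : Coalgebra.Repr k h ι) :
    rightAdjoint k a h = ∑ i ∈ r.index, antipode k (r.left i) * (a * r.right i) := by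
  simp [rightAdjoint, ← r.eq]

theorem leftAdjoint_mul_right (a x y : H) :
    leftAdjoint k a (x * y) = leftAdjoint k (leftAdjoint k a y) x := by
  rw [leftAdjoint_eq_sum _ ((ℛ k x).mul (ℛ k y)), leftAdjoint_eq_sum _ (ℛ k x),
    leftAdjoint_eq_sum _ (ℛ k y)]
  simp [Coalgebra.Repr.mul, Finset.sum_product, antipode_mul_antidistrib, Finset.mul_sum,
    Finset.sum_mul, mul_assoc]

theorem rightAdjoint_mul_right (a x y : H) :
    rightAdjoint k a (x * y) = rightAdjoint k (rightAdjoint k a x) y := by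
  rw [rightAdjoint_eq_sum _ ((ℛ k x).mul (ℛ k y)), rightAdjoint_eq_sum _ (ℛ k y),
    rightAdjoint_eq_sum _ (ℛ k x)]
  simp [Coalgebra.Repr.mul, Finset.sum_product_right, antipode_mul_antidistrib, Finset.mul_sum,
    Finset.sum_mul, mul_assoc]

theorem leftAdjoint_add (a b h : H) :
    leftAdjoint k (a + b) h = leftAdjoint k a h + leftAdjoint k b h := by
  simp [leftAdjoint_eq_sum _ (ℛ k h), mul_add, add_mul, Finset.sum_add_distrib]

theorem rightAdjoint_add (a b h : H) :
    rightAdjoint k (a + b) h = rightAdjoint k a h + rightAdjoint k b h := by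
  simp [rightAdjoint_eq_sum _ (ℛ k h), mul_add, add_mul, Finset.sum_add_distrib]

theorem leftAdjoint_smul (c : k) (a h : H) :
    leftAdjoint k (c • a) h = c • leftAdjoint k a h := by
  simp [leftAdjoint_eq_sum _ (ℛ k h), Finset.smul_sum]

theorem rightAdjoint_smul (c : k) (a h : H) :
    rightAdjoint k (c • a) h = c • rightAdjoint k a h := by
  simp [rightAdjoint_eq_sum _ (ℛ k h), Finset.smul_sum]

/-- If `a` commutes with a subcoalgebra containing `h`, then `h₁ a S(h₂) = ε(h) a`. -/
theorem leftAdjoint_of_commute (L : HopfSubalgebra k H) {a h : H}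
    (ha : ∀ l ∈ L.toSubalgebra, a * l = l * a) (hh : h ∈ L.toSubalgebra) :
    leftAdjoint k a h = counit (R := k) h • a := by
  obtain ⟨t, ht⟩ := L.comul_mem' h hh
  -- Moving `a` past the left leg, which lies in `L`, leaves `a h₁ S(h₂)`.
  have key : ∀ t : L.toSubalgebra ⊗[k] L.toSubalgebra,
      (LinearMap.mul' k H ∘ₗ TensorProduct.map (LinearMap.mulRight k a) (antipode k))
        (Algebra.TensorProduct.map L.toSubalgebra.val L.toSubalgebra.val t) =
      a * (LinearMap.mul' k H ∘ₗ (antipode k).lTensor H)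
        (Algebra.TensorProduct.map L.toSubalgebra.val L.toSubalgebra.val t) := by
    intro t
    induction t with
    | zero => simp
    | add x y hx hy => simp only [map_add, hx, hy, mul_add]
    | tmul x y => simp [← ha x x.2, mul_assoc]
  have h1 := key t
  erw [ht] at h1
  refine h1.trans ?_
  have := HopfAlgebra.mul_antipode_lTensor_comul_apply (R := k) h
  rw [LinearMap.comp_apply, this, ← Algebra.commutes, ← Algebra.smul_def]

/-- If `a` commutes with a subcoalgebra containing `h`, then `S(h₁) a h₂ = ε(h) a`. -/
theorem rightAdjoint_of_commute (L : HopfSubalgebra k H) {a h : H}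
    (ha : ∀ l ∈ L.toSubalgebra, a * l = l * a) (hh : h ∈ L.toSubalgebra) :
    rightAdjoint k a h = counit (R := k) h • a := by
  obtain ⟨t, ht⟩ := L.comul_mem' h hh
  have key : ∀ t : L.toSubalgebra ⊗[k] L.toSubalgebra,
      (LinearMap.mul' k H ∘ₗ TensorProduct.map (antipode k) (LinearMap.mulLeft k a))
        (Algebra.TensorProduct.map L.toSubalgebra.val L.toSubalgebra.val t) =
      (LinearMap.mul' k H ∘ₗ (antipode k).rTensor H)
        (Algebra.TensorProduct.map L.toSubalgebra.val L.toSubalgebra.val t) * a := by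
    intro t
    induction t with
    | zero => simp
    | add x y hx hy => simp only [map_add, hx, hy, add_mul]
    | tmul x y => simp [ha y y.2, mul_assoc]
  have h1 := key t
  erw [ht] at h1
  refine h1.trans ?_
  have := HopfAlgebra.mul_antipode_rTensor_comul_apply (R := k) h
  rw [LinearMap.comp_apply, this, ← Algebra.smul_def]

theorem sum_counit_right_smul {h : H} {ι : Type*} (r : Coalgebra.Repr k h ι) :
    ∑ i ∈ r.index, counit (R := k) (r.right i) • r.left i = h := by
  have h1 := congrArg (TensorProduct.rid k H) (sum_tmul_counit_eq (R := k) r)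
  simpa only [map_sum, TensorProduct.rid_tmul, one_smul] using h1

/-- The left adjoint action is compatible with multiplication:
`ad(h)(ab) = ad(h₁)(a) ad(h₂)(b)`. -/
theorem leftAdjoint_mul (a b : H) :
    toConv (leftAdjoint k (a * b)) = toConv (leftAdjoint k a) * toConv (leftAdjoint k b) := by
  -- With `R_a` right multiplication, `ad(·)(a) = R_a * S`. In `R_a * S * R_b * S` the middle `S *
  -- R_b` collapses to `b ε`, and `R_a * b ε = R_{ab}`.
  have hl (a : H) : toConv (leftAdjoint k a) =
      toConv (LinearMap.mulRight k a) * toConv (antipode k) := rfl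
  have h1 : toConv (antipode k) * toConv (LinearMap.mulRight k b) =
      toConv (LinearMap.toSpanSingleton k H b ∘ₗ counit) := by
    ext h
    rw [(ℛ k h).convMul_apply]
    simp [← mul_assoc, ← Finset.sum_mul, sum_antipode_mul_eq_smul (ℛ k h)]
  have h2 : toConv (LinearMap.mulRight k a) *
      toConv (LinearMap.toSpanSingleton k H b ∘ₗ counit) =
      toConv (LinearMap.mulRight k (a * b)) := by
    ext h
    rw [(ℛ k h).convMul_apply]
    have := congrArg (· * (a * b)) (sum_counit_right_smul (k := k) (ℛ k h))
    simpa [Finset.sum_mul, mul_assoc] using this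
  rw [hl, hl, hl, mul_assoc, ← mul_assoc (toConv (antipode k)), h1, ← mul_assoc, h2]

/-- The right adjoint action is compatible with multiplication. -/
theorem rightAdjoint_mul (a b : H) :
    toConv (rightAdjoint k (a * b)) = toConv (rightAdjoint k a) * toConv (rightAdjoint k b) := by
  have hl (a : H) : toConv (rightAdjoint k a) =
      toConv (antipode k) * toConv (LinearMap.mulLeft k a) := rfl
  have h1 : toConv (LinearMap.mulLeft k a) * toConv (antipode k) =
      toConv (LinearMap.toSpanSingleton k H a ∘ₗ counit) := by
    ext h
    rw [(ℛ k h).convMul_apply]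
    simp [mul_assoc, ← Finset.mul_sum, sum_mul_antipode_eq_smul (ℛ k h)]
  have h2 : toConv (LinearMap.toSpanSingleton k H a ∘ₗ counit) *
      toConv (LinearMap.mulLeft k b) = toConv (LinearMap.mulLeft k (a * b)) := by
    ext h
    rw [(ℛ k h).convMul_apply]
    have := congrArg (a * b * ·) (sum_counit_smul (R := k) (ℛ k h))
    simpa [Finset.mul_sum, mul_assoc] using this
  rw [hl, hl, hl, mul_assoc, ← mul_assoc (toConv (LinearMap.mulLeft k a)), h1, h2]

theorem leftAdjoint_one (h : H) : leftAdjoint k 1 h = algebraMap k H (counit h) := by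
  simp [leftAdjoint_eq_sum _ (ℛ k h), sum_mul_antipode_eq_algebraMap_counit]

theorem rightAdjoint_one (h : H) : rightAdjoint k 1 h = algebraMap k H (counit h) := by
  simp [rightAdjoint_eq_sum _ (ℛ k h), sum_antipode_mul_eq_algebraMap_counit]

theorem map_leftAdjoint {D : Type*} [Ring D] [HopfAlgebra k D] (f : H →ₐc[k] D) (a h : H) :
    f (leftAdjoint k a h) = leftAdjoint k (f a) (f h) := by
  rw [leftAdjoint_eq_sum _ (ℛ k h), leftAdjoint_eq_sum _ ((ℛ k h).induced f)]
  simp [BialgHom.map_antipode]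

theorem map_rightAdjoint {D : Type*} [Ring D] [HopfAlgebra k D] (f : H →ₐc[k] D) (a h : H) :
    f (rightAdjoint k a h) = rightAdjoint k (f a) (f h) := by
  rw [rightAdjoint_eq_sum _ (ℛ k h), rightAdjoint_eq_sum _ ((ℛ k h).induced f)]
  simp [BialgHom.map_antipode]

/-- The Hopf subalgebra generated by normal Hopf subalgebras is normal. -/
theorem generated_isNormal {ι : Type*} (K : ι → HopfSubalgebra k H) (hK : ∀ i, (K i).IsNormal) :
    (generated K).IsNormal := by
  intro h a ha
  -- The product case evaluates the induction hypotheses at the Sweedler components of `h`, so `h`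
  -- has to vary.
  suffices H : ∀ h, leftAdjoint k a h ∈ (generated K).toSubalgebra ∧
      rightAdjoint k a h ∈ (generated K).toSubalgebra from H h
  refine Algebra.iSup_induction (fun i => (K i).toSubalgebra)
    (motive := fun a => ∀ h, leftAdjoint k a h ∈ (generated K).toSubalgebra ∧
      rightAdjoint k a h ∈ (generated K).toSubalgebra) ha ?_ ?_ ?_ ?_
  · exact fun i a ha h => ⟨le_generated K i (hK i h a ha).1, le_generated K i (hK i h a ha).2⟩
  · intro a b ha hb h
    rw [leftAdjoint_add, rightAdjoint_add]
    exact ⟨add_mem (ha h).1 (hb h).1, add_mem (ha h).2 (hb h).2⟩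
  · intro a b ha hb h
    have h1 := congrArg (fun f => f.ofConv h) (leftAdjoint_mul (k := k) a b)
    have h2 := congrArg (fun f => f.ofConv h) (rightAdjoint_mul (k := k) a b)
    have h1' := h1.trans ((ℛ k h).convMul_apply _ _)
    have h2' := h2.trans ((ℛ k h).convMul_apply _ _)
    constructor
    · refine Eq.mpr (congrArg (· ∈ _) h1') ?_
      exact sum_mem fun i _ => mul_mem (ha _).1 (hb _).1
    · refine Eq.mpr (congrArg (· ∈ _) h2') ?_
      exact sum_mem fun i _ => mul_mem (ha _).2 (hb _).2
  · intro r h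
    rw [Algebra.algebraMap_eq_smul_one, leftAdjoint_smul, rightAdjoint_smul, leftAdjoint_one,
      rightAdjoint_one]
    exact ⟨Subalgebra.smul_mem _ (Subalgebra.algebraMap_mem _ _) _,
      Subalgebra.smul_mem _ (Subalgebra.algebraMap_mem _ _) _⟩

/-- On a Hopf subalgebra `B`, a convolution product depends only on the restrictions to `B`. -/
theorem convMul_congr (B : HopfSubalgebra k H) {f f' g g' : H →ₗ[k] H}
    (hf : ∀ b ∈ B.toSubalgebra, f b = f' b) (hg : ∀ b ∈ B.toSubalgebra, g b = g' b) {b : H}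
    (hb : b ∈ B.toSubalgebra) :
    (toConv f * toConv g).ofConv b = (toConv f' * toConv g').ofConv b := by
  obtain ⟨t, ht⟩ := B.comul_mem' b hb
  rw [LinearMap.convMul_def, LinearMap.convMul_def]
  simp only [LinearMap.comp_apply]
  rw [← ht]
  clear ht
  induction t with
  | zero => simp
  | add x y hx hy => simp only [map_add, hx, hy]
  | tmul x y => simp [hf x x.2, hg y y.2]

/-- Convolution products of maps with values in a subalgebra have values in it. -/
theorem convMul_mem_of_forall {E : Subalgebra k H} {f g : H →ₗ[k] H} (hf : ∀ b, f b ∈ E)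
    (hg : ∀ b, g b ∈ E) (b : H) : (toConv f * toConv g).ofConv b ∈ E := by
  refine Eq.mpr (congrArg (· ∈ E) ((ℛ k b).convMul_apply _ _)) ?_
  exact sum_mem fun i _ => mul_mem (hf _) (hg _)

end Adjoint

/-! ### Images and corestrictions -/

section Map

variable {k C H : Type*} [Field k] [Ring C] [HopfAlgebra k C] [Ring H] [HopfAlgebra k H]

/-- The image of a Hopf subalgebra under a homomorphism of Hopf algebras. -/
def map (f : C →ₐc[k] H) (M : HopfSubalgebra k C) : HopfSubalgebra k H where
  toSubalgebra := M.toSubalgebra.map (f : C →ₐ[k] H)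
  comul_mem' := by
    rintro _ ⟨x, hx, rfl⟩
    obtain ⟨t, ht⟩ := M.comul_mem' x hx
    set g : M.toSubalgebra →ₐ[k] M.toSubalgebra.map (f : C →ₐ[k] H) :=
      ((f : C →ₐ[k] H).comp M.toSubalgebra.val).codRestrict _ fun y => ⟨y, y.2, rfl⟩
    refine ⟨Algebra.TensorProduct.map g g t, ?_⟩
    have h1 := CoalgHomClass.map_comp_comul_apply f x
    refine Eq.trans ?_ h1
    rw [← ht]
    clear ht
    induction t with
    | zero => simp
    | add x y hx hy => simp only [map_add, hx, hy]
    | tmul x y => rfl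
  antipode_mem' := by
    rintro _ ⟨x, hx, rfl⟩
    exact ⟨antipode k x, M.antipode_mem' x hx, BialgHom.map_antipode f x⟩

instance : Top (HopfSubalgebra k H) where
  top :=
    { toSubalgebra := ⊤
      comul_mem' := fun x _ => by
        induction (comul x : H ⊗[k] H) with
        | zero => exact zero_mem _
        | add x y hx hy => exact add_mem hx hy
        | tmul x y => exact ⟨⟨x, trivial⟩ ⊗ₜ ⟨y, trivial⟩, rfl⟩
      antipode_mem' := fun _ _ => trivial }

/-- The image of a homomorphism of Hopf algebras. -/
def range (f : C →ₐc[k] H) : HopfSubalgebra k H := map f ⊤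

theorem mem_range {f : C →ₐc[k] H} {x : H} : x ∈ (range f).toSubalgebra ↔ ∃ y, f y = x :=
  ⟨fun ⟨y, _, hy⟩ => ⟨y, hy⟩, fun ⟨y, hy⟩ => ⟨y, trivial, hy⟩⟩

theorem apply_mem_range (f : C →ₐc[k] H) (x : C) : f x ∈ (range f).toSubalgebra :=
  mem_range.2 ⟨x, rfl⟩

/-- The inclusion of a Hopf subalgebra as a homomorphism of Hopf algebras. -/
noncomputable def incl (K : HopfSubalgebra k H) : K.toSubalgebra →ₐc[k] H :=
  BialgHom.ofAlgHom K.toSubalgebra.val rfl (AlgHom.ext K.map_val_comulRestrict)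

/-- Corestriction of a homomorphism of Hopf algebras to a Hopf subalgebra. -/
noncomputable def codRestrict (f : C →ₐc[k] H) (K : HopfSubalgebra k H)
    (hf : ∀ x, f x ∈ K.toSubalgebra) : C →ₐc[k] K.toSubalgebra :=
  BialgHom.ofAlgHom ((f : C →ₐ[k] H).codRestrict K.toSubalgebra hf)
    (AlgHom.ext fun x => CoalgHomClass.counit_comp_apply f x) <| by
    ext x
    apply K.map_val_injective
    refine Eq.trans ?_ (K.map_val_comulRestrict _).symm
    refine Eq.trans ?_ (CoalgHomClass.map_comp_comul_apply f x)
    simp only [AlgHom.comp_apply, Bialgebra.comulAlgHom_apply]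
    induction (comul x : C ⊗[k] C) with
    | zero => simp
    | add x y hx hy => simp only [map_add, hx, hy]
    | tmul x y => rfl

end Map

end HopfSubalgebra

namespace HopfSubalgebra

/-! ### Projections onto tensor factors -/

section FactorProjection

variable {k H : Type*} [Field k] [Ring H] [HopfAlgebra k H]

/-- An endomorphism `π` of `H` is adjoint-equivariant if the adjoint actions of `H` on its image
factor through `π`. -/
structure IsAdjointEquivariant (π : H →ₐc[k] H) : Prop where
  left : ∀ a h, leftAdjoint k (π a) h = leftAdjoint k (π a) (π h)
  right : ∀ a h, rightAdjoint k (π a) h = rightAdjoint k (π a) (π h)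

/-- The bialgebra endomorphism `π` is a projection of `H` onto a normal tensor factor along the
Hopf subalgebra `L`: it is idempotent and adjoint-equivariant, trivial on `L`, and `π = id * θ`
for a linear map `θ` with values in `L`. -/
structure IsFactorProjection (π : H →ₐc[k] H) (L : HopfSubalgebra k H) : Prop where
  equivariant : IsAdjointEquivariant π
  idem : ∀ x, π (π x) = π x
  apply_of_mem : ∀ x ∈ L.toSubalgebra, π x = algebraMap k H (counit x)
  exists_conv : ∃ θ : H →ₗ[k] H, (∀ x, θ x ∈ L.toSubalgebra) ∧
    toConv (π : H →ₐ[k] H).toLinearMap = toConv LinearMap.id * toConv θ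

/-- Homomorphisms respect adjoint actions, so `ad(πβa)(πh) = π(ad(βa)(h)) = π(ad(βa)(βh))`, writing
`ad(a)(h)` for `leftAdjoint k a h`. -/
theorem IsAdjointEquivariant.comp {π β : H →ₐc[k] H} (hπ : IsAdjointEquivariant π)
    (hβ : IsAdjointEquivariant β) : IsAdjointEquivariant (π.comp β) where
  left a h := by
    simp only [BialgHom.comp_apply]
    rw [hπ.left, ← map_leftAdjoint, hβ.left, map_leftAdjoint]
  right a h := by
    simp only [BialgHom.comp_apply]
    rw [hπ.right, ← map_rightAdjoint, hβ.right, map_rightAdjoint]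

theorem IsAdjointEquivariant.range_isNormal {π : H →ₐc[k] H} (hπ : IsAdjointEquivariant π) :
    (range π).IsNormal := by
  rintro h a ha
  obtain ⟨a, rfl⟩ := mem_range.1 ha
  rw [hπ.left, hπ.right, ← map_leftAdjoint, ← map_rightAdjoint]
  exact ⟨apply_mem_range _ _, apply_mem_range _ _⟩

theorem IsFactorProjection.apply_of_mem_range {π : H →ₐc[k] H} {L : HopfSubalgebra k H}
    (hπ : IsFactorProjection π L) {x : H} (hx : x ∈ (range π).toSubalgebra) : π x = x := by
  obtain ⟨y, rfl⟩ := mem_range.1 hx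
  exact hπ.idem y

theorem comp_conv (f : H →ₐc[k] H) (g h : H →ₗ[k] H) :
    toConv ((f : H →ₐ[k] H).toLinearMap ∘ₗ (toConv g * toConv h).ofConv) =
      toConv ((f : H →ₐ[k] H).toLinearMap ∘ₗ g) * toConv ((f : H →ₐ[k] H).toLinearMap ∘ₗ h) :=
  WithConv.ext (LinearMap.algHom_comp_convMul_distrib (f : H →ₐ[k] H) (toConv g) (toConv h))

/-- A homomorphism that is trivial on `L` factors through the projection along `L`. -/
theorem IsFactorProjection.comp_apply {π : H →ₐc[k] H} {L : HopfSubalgebra k H}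
    (hπ : IsFactorProjection π L) {f : H →ₐc[k] H}
    (hf : ∀ x ∈ L.toSubalgebra, f x = algebraMap k H (counit x)) (x : H) : f (π x) = f x := by
  obtain ⟨θ, hθ, h⟩ := hπ.exists_conv
  -- Applying `ε` to `π = id * θ` gives `ε ∘ θ = ε`. Hence `f ∘ θ` is the convolution unit and `f ∘
  -- π = f * (f ∘ θ) = f`.
  have hε : toConv (counit (R := k) (A := H) ∘ₗ θ) = 1 := by
    have h1 := LinearMap.algHom_comp_convMul_distrib (Bialgebra.counitAlgHom k H)
      (toConv LinearMap.id) (toConv θ)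
    rw [← h] at h1
    have h2 : toConv ((Bialgebra.counitAlgHom k H).toLinearMap ∘ₗ LinearMap.id) = 1 := rfl
    have h3 : (Bialgebra.counitAlgHom k H).toLinearMap ∘ₗ (π : H →ₐ[k] H).toLinearMap =
        counit := LinearMap.ext fun x => CoalgHomClass.counit_comp_apply π x
    have h4 := h1.symm.trans h3
    change (toConv ((Bialgebra.counitAlgHom k H).toLinearMap ∘ₗ LinearMap.id) *
      toConv (counit (R := k) (A := H) ∘ₗ θ)).ofConv = _ at h4
    rw [h2, one_mul] at h4
    exact WithConv.ext h4
  have h1 := comp_conv f LinearMap.id θ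
  rw [← h] at h1
  have h2 : toConv ((f : H →ₐ[k] H).toLinearMap ∘ₗ θ) = 1 := by
    ext x
    refine (hf _ (hθ x)).trans ?_
    exact congrArg (algebraMap k H) (LinearMap.congr_fun (congrArg ofConv hε) x)
  rw [h2, mul_one] at h1
  exact LinearMap.congr_fun (congrArg ofConv h1) x

/-- The starting point of the induction: `H` as a factor of itself, with `θ` the convolution unit.
-/
theorem isFactorProjection_id (L : HopfSubalgebra k H) (hL : L.toSubalgebra = ⊥) :
    IsFactorProjection (BialgHom.id k H) L where
  equivariant := ⟨fun _ _ => rfl, fun _ _ => rfl⟩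
  idem _ := rfl
  apply_of_mem x hx := by
    rw [hL] at hx
    obtain ⟨r, rfl⟩ := Algebra.mem_bot.1 hx
    simp
  exists_conv := ⟨Algebra.linearMap k H ∘ₗ counit, fun x => L.toSubalgebra.algebraMap_mem _,
    (mul_one (toConv LinearMap.id)).symm⟩

/-- The projections onto the two factors of a tensor factorization. -/
theorem IsTensorFactorization.exists_projections {B C : HopfSubalgebra k H}
    (h : IsTensorFactorization B C) :
    ∃ β γ : H →ₐc[k] H,
      (∀ b ∈ B.toSubalgebra, ∀ c ∈ C.toSubalgebra, β (b * c) = counit (R := k) c • b) ∧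
      (∀ b ∈ B.toSubalgebra, ∀ c ∈ C.toSubalgebra, γ (b * c) = counit (R := k) b • c) ∧
      (∀ b ∈ B.toSubalgebra, ∀ c ∈ C.toSubalgebra, b * c = c * b) ∧
      (∀ x, β x ∈ B.toSubalgebra) ∧ (∀ x, γ x ∈ C.toSubalgebra) ∧
      Submodule.span k {x | ∃ b ∈ B.toSubalgebra, ∃ c ∈ C.toSubalgebra, b * c = x} = ⊤ := by
  obtain ⟨e, he⟩ := h
  have hsymm (b : B.toSubalgebra) (c : C.toSubalgebra) :
      e.symm ((b : H) * (c : H)) = b ⊗ₜ c := by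
    rw [← he, BialgEquiv.symm_apply_apply]
  set p : H →ₐc[k] B.toSubalgebra :=
    (((Bialgebra.TensorProduct.rid k k B.toSubalgebra : _ →ₐc[k] B.toSubalgebra).comp
      (Bialgebra.TensorProduct.map (BialgHom.id k B.toSubalgebra)
        (Bialgebra.counitBialgHom k C.toSubalgebra))).comp
      (e.symm : H →ₐc[k] B.toSubalgebra ⊗[k] C.toSubalgebra))
  set q : H →ₐc[k] C.toSubalgebra :=
    (((Bialgebra.TensorProduct.lid k C.toSubalgebra : _ →ₐc[k] C.toSubalgebra).comp
      (Bialgebra.TensorProduct.map (Bialgebra.counitBialgHom k B.toSubalgebra)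
        (BialgHom.id k C.toSubalgebra))).comp
      (e.symm : H →ₐc[k] B.toSubalgebra ⊗[k] C.toSubalgebra))
  refine ⟨B.incl.comp p, C.incl.comp q, ?_, ?_, ?_, fun x => (p x).2, fun x => (q x).2, ?_⟩
  · intro b hb c hc
    have h1 := hsymm ⟨b, hb⟩ ⟨c, hc⟩
    have : p (b * c) = counit (R := k) c • ⟨b, hb⟩ := by
      change (Bialgebra.TensorProduct.rid k k B.toSubalgebra) (Bialgebra.TensorProduct.map
        (BialgHom.id k B.toSubalgebra) (Bialgebra.counitBialgHom k C.toSubalgebra)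
          (e.symm (b * c))) = _
      erw [h1]
      rfl
    exact congrArg Subtype.val this
  · intro b hb c hc
    have h1 := hsymm ⟨b, hb⟩ ⟨c, hc⟩
    have : q (b * c) = counit (R := k) b • ⟨c, hc⟩ := by
      change (Bialgebra.TensorProduct.lid k C.toSubalgebra) (Bialgebra.TensorProduct.map
        (Bialgebra.counitBialgHom k B.toSubalgebra) (BialgHom.id k C.toSubalgebra)
          (e.symm (b * c))) = _
      erw [h1]
      rfl
    exact congrArg Subtype.val this
  · intro b hb c hc
    have h1 := he ⟨b, hb⟩ ⟨c, hc⟩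
    have h2 : (⟨b, hb⟩ : B.toSubalgebra) ⊗ₜ[k] (⟨c, hc⟩ : C.toSubalgebra) =
      (1 ⊗ₜ ⟨c, hc⟩) * (⟨b, hb⟩ ⊗ₜ 1) := by simp
    rw [h2, map_mul, he, he] at h1
    simpa using h1.symm
  · rw [eq_top_iff]
    rintro x -
    obtain ⟨t, rfl⟩ : ∃ t, e t = x := ⟨e.symm x, e.apply_symm_apply x⟩
    induction t with
    | zero => simp
    | add x y hx hy => rw [map_add]; exact add_mem hx hy
    | tmul b c => exact Submodule.subset_span ⟨b, b.2, c, c.2, (he b c).symm⟩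

/-- Since `C` commutes with `B`, it acts on `B` through `ε`, so `bc` acts as `ε(c) b = β(bc)`;
symmetrically for `γ`. The map `θ` is `S ∘ γ`, valued in `C`. The formula `β = id * Sγ` is returned
as well, since the splitting step needs this particular `θ`. -/
theorem IsTensorFactorization.exists_isFactorProjection {B C : HopfSubalgebra k H}
    (h : IsTensorFactorization B C) :
    ∃ β γ : H →ₐc[k] H, IsFactorProjection β C ∧ IsAdjointEquivariant γ ∧
      (∀ x, β x ∈ B.toSubalgebra) ∧ (∀ b ∈ B.toSubalgebra, β b = b) ∧
      (∀ x, γ x ∈ C.toSubalgebra) ∧ (∀ c ∈ C.toSubalgebra, γ c = c) ∧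
      (∀ b ∈ B.toSubalgebra, γ b = algebraMap k H (counit b)) ∧
      toConv (β : H →ₐ[k] H).toLinearMap =
        toConv LinearMap.id * toConv (antipode k ∘ₗ (γ : H →ₐ[k] H).toLinearMap) := by
  obtain ⟨β, γ, hβ, hγ, hcomm, hβB, hγC, hspan⟩ := h.exists_projections
  have hβb (b) (hb : b ∈ B.toSubalgebra) : β b = b := by
    simpa using hβ b hb 1 (one_mem _)
  have hβc (c) (hc : c ∈ C.toSubalgebra) : β c = algebraMap k H (counit c) := by
    simpa [Algebra.algebraMap_eq_smul_one] using hβ 1 (one_mem _) c hc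
  have hγc (c) (hc : c ∈ C.toSubalgebra) : γ c = c := by
    simpa using hγ 1 (one_mem _) c hc
  have hγb (b) (hb : b ∈ B.toSubalgebra) : γ b = algebraMap k H (counit b) := by
    simpa [Algebra.algebraMap_eq_smul_one] using hγ b hb 1 (one_mem _)
  have hext {f g : H →ₗ[k] H}
      (hfg : ∀ b ∈ B.toSubalgebra, ∀ c ∈ C.toSubalgebra, f (b * c) = g (b * c)) : f = g := by
    refine LinearMap.ext_on hspan ?_
    rintro _ ⟨b, hb, c, hc, rfl⟩
    exact hfg b hb c hc
  have hconv : toConv (β : H →ₐ[k] H).toLinearMap =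
      toConv LinearMap.id * toConv (antipode k ∘ₗ (γ : H →ₐ[k] H).toLinearMap) := by
    set s : H →ₗ[k] H := antipode k ∘ₗ (γ : H →ₐ[k] H).toLinearMap with hs
    set f := (toConv LinearMap.id * toConv s).ofConv
    have hfc (c) (hc : c ∈ C.toSubalgebra) : f c = algebraMap k H (counit c) := by
      refine (convMul_congr C (f' := LinearMap.id) (g' := antipode k) (fun _ _ => rfl)
        (fun c hc => show antipode k (γ c) = antipode k c by rw [hγc c hc]) hc).trans ?_
      rw [LinearMap.id_mul_antipode]
      rfl
    have hfb (b) (hb : b ∈ B.toSubalgebra) : f b = b := by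
      refine (convMul_congr B (f' := LinearMap.id) (g' := Algebra.linearMap k H ∘ₗ counit)
        (fun _ _ => rfl) (fun b hb => ?_) hb).trans ?_
      · refine (congrArg (antipode k) (hγb b hb)).trans ?_
        simp [Algebra.algebraMap_eq_smul_one]
      · rw [← LinearMap.convOne_def, mul_one]
        rfl
    refine WithConv.ext (hext fun b hb c hc => ?_)
    change β (b * c) = f (b * c)
    have hsum (x : H) {ι : Type _} (r : Coalgebra.Repr k x ι) :
        f x = ∑ i ∈ r.index, r.left i * s (r.right i) := r.convMul_apply _ _
    have hsmul (x y : H) : s (x * y) = s y * s x := by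
      simp [hs, antipode_mul_antidistrib]
    -- As `s` reverses products, `f(bc) = b₁ (c₁ s(c₂)) s(b₂)`; the inner bracket is the scalar
    -- `f(c) = ε(c)`.
    have h1 : f (b * c) = ∑ i ∈ (ℛ k b).index,
        (ℛ k b).left i * f c * s ((ℛ k b).right i) := by
      rw [hsum _ ((ℛ k b).mul (ℛ k c)), hsum c (ℛ k c)]
      simp [Coalgebra.Repr.mul, Finset.sum_product, hsmul, Finset.mul_sum, Finset.sum_mul,
        mul_assoc]
    rw [h1, hfc c hc, hβ b hb c hc]
    simp only [Algebra.algebraMap_eq_smul_one, mul_smul_comm, mul_one, smul_mul_assoc]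
    rw [← Finset.smul_sum, ← hsum b, hfb b hb]
  have hβe : IsAdjointEquivariant β := by
    constructor
    · intro a h
      have ha := hβB a
      suffices leftAdjoint k (β a) = leftAdjoint k (β a) ∘ₗ (β : H →ₐ[k] H).toLinearMap from
        LinearMap.congr_fun this h
      refine hext fun b hb c hc => ?_
      change _ = leftAdjoint k (β a) (β (b * c))
      rw [hβ b hb c hc, leftAdjoint_mul_right,
        leftAdjoint_of_commute C (fun l hl => hcomm _ ha l hl) hc, leftAdjoint_smul, map_smul]
    · intro a h
      have ha := hβB a
      suffices rightAdjoint k (β a) = rightAdjoint k (β a) ∘ₗ (β : H →ₐ[k] H).toLinearMap from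
        LinearMap.congr_fun this h
      refine hext fun b hb c hc => ?_
      change _ = rightAdjoint k (β a) (β (b * c))
      -- The right action applies the left letter of a product first, so `bc` is turned into `cb` to
      -- let `c` act directly on `β a`.
      rw [hβ b hb c hc, hcomm b hb c hc, rightAdjoint_mul_right,
        rightAdjoint_of_commute C (fun l hl => hcomm _ ha l hl) hc, rightAdjoint_smul, map_smul]
  have hγe : IsAdjointEquivariant γ := by
    constructor
    · intro a h
      have ha := hγC a
      suffices leftAdjoint k (γ a) = leftAdjoint k (γ a) ∘ₗ (γ : H →ₐ[k] H).toLinearMap from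
        LinearMap.congr_fun this h
      refine hext fun b hb c hc => ?_
      change _ = leftAdjoint k (γ a) (γ (b * c))
      rw [hγ b hb c hc, hcomm b hb c hc, leftAdjoint_mul_right,
        leftAdjoint_of_commute B (fun l hl => (hcomm l hl _ ha).symm) hb, leftAdjoint_smul,
        map_smul]
    · intro a h
      have ha := hγC a
      suffices rightAdjoint k (γ a) = rightAdjoint k (γ a) ∘ₗ (γ : H →ₐ[k] H).toLinearMap from
        LinearMap.congr_fun this h
      refine hext fun b hb c hc => ?_
      change _ = rightAdjoint k (γ a) (γ (b * c))
      rw [hγ b hb c hc, rightAdjoint_mul_right,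
        rightAdjoint_of_commute B (fun l hl => (hcomm l hl _ ha).symm) hb, rightAdjoint_smul,
        map_smul]
  exact ⟨β, γ, ⟨hβe, fun x => hβb _ (hβB x), hβc,
    antipode k ∘ₗ (γ : H →ₐ[k] H).toLinearMap, fun x => C.antipode_mem' (γ x) (hγC x), hconv⟩,
    hγe, hβB, hβb, hγC, hγc, hγb, hconv⟩

end FactorProjection

end HopfSubalgebra

/-! ### Integrals and finite-dimensionality -/

section FiniteDimensional

variable {k H : Type*} [Field k] [Ring H] [HopfAlgebra k H]

/-- A semisimple Hopf algebra has a left integral `Λ` with `ε(Λ) = 1`. -/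
theorem exists_normalized_integral (k H : Type*) [Field k] [Ring H] [HopfAlgebra k H]
    [IsSemisimpleRing H] :
    ∃ Λ : H, counit (R := k) Λ = 1 ∧ ∀ h : H, h * Λ = counit (R := k) h • Λ := by
  -- `Λ` is the component of `1` in a left ideal `J` complementary to the augmentation ideal `I`;
  -- then `hΛ - ε(h)Λ` lies in `I ∩ J = 0`.
  let I : Submodule H H := RingHom.ker (Bialgebra.counitAlgHom k H)
  have hI (x : H) : x ∈ I ↔ counit (R := k) x = 0 := Iff.rfl
  obtain ⟨J, hJ⟩ := exists_isCompl I
  obtain ⟨y, hy, Λ, hΛ, hyΛ⟩ := Submodule.mem_sup.1 (hJ.sup_eq_top ▸ Submodule.mem_top :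
    (1 : H) ∈ I ⊔ J)
  have hε : counit (R := k) Λ = 1 := by
    have := congrArg (counit (R := k)) hyΛ
    rwa [map_add, (hI y).1 hy, zero_add, Bialgebra.counit_one] at this
  refine ⟨Λ, hε, fun h => sub_eq_zero.1 ?_⟩
  refine (Submodule.disjoint_def.1 hJ.disjoint) _ ?_ ?_
  · rw [hI]
    simp [hε]
  · refine sub_mem (J.smul_mem h hΛ) ?_
    rw [← one_mul Λ, ← smul_mul_assoc]
    exact J.smul_mem _ hΛ

/-- The identity `S(h₁) h₂ ⊗ h₃ = 1 ⊗ h`. -/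
theorem sum_antipode_tmul_one_mul_comul {h : H} {ι : Type*} (r : Coalgebra.Repr k h ι) :
    ∑ i ∈ r.index, (antipode k (r.left i) ⊗ₜ[k] (1 : H)) * comul (R := k) (r.right i) =
      1 ⊗ₜ[k] h := by
  let i₁ : H →ₐ[k] H ⊗[k] H := Algebra.TensorProduct.includeLeft
  let i₂ : H →ₐ[k] H ⊗[k] H := Algebra.TensorProduct.includeRight
  -- Writing `Δ = i₁ * i₂` and cancelling `i₁` with its left inverse `i₁ ∘ S` leaves `i₂`.
  have h1 : toConv (comul (R := k) (A := H)) = toConv i₁.toLinearMap * toConv i₂.toLinearMap := by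
    ext x
    rw [(ℛ k x).convMul_apply]
    simpa [i₁, i₂] using (ℛ k x).eq.symm
  have h2 : toConv (i₁.toLinearMap ∘ₗ antipode k) * toConv i₁.toLinearMap = 1 := by
    have h := LinearMap.algHom_comp_convMul_distrib i₁ (toConv (antipode k (A := H)))
      (toConv LinearMap.id)
    rw [LinearMap.antipode_mul_id] at h
    apply WithConv.ext
    refine h.symm.trans ?_
    ext x
    exact i₁.commutes _
  have h3 : toConv (i₁.toLinearMap ∘ₗ antipode k) * toConv (comul (R := k) (A := H)) =
      toConv i₂.toLinearMap := by
    rw [h1, ← mul_assoc, h2, one_mul]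
  exact (r.convMul_apply _ _).symm.trans (LinearMap.congr_fun (congrArg ofConv h3) h)

/-- A left integral satisfies `Λ₁ ⊗ h Λ₂ = S(h) Λ₁ ⊗ Λ₂`. -/
theorem one_tmul_mul_comul_of_integral {Λ : H} (hΛ : ∀ h : H, h * Λ = counit (R := k) h • Λ)
    (h : H) : (1 ⊗ₜ[k] h) * comul (R := k) Λ = (antipode k h ⊗ₜ[k] 1) * comul (R := k) Λ := by
  rw [← sum_antipode_tmul_one_mul_comul (ℛ k h), Finset.sum_mul]
  conv_rhs => rw [← HopfSubalgebra.sum_counit_right_smul (ℛ k h)]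
  simp only [mul_assoc, ← Bialgebra.comul_mul, hΛ, map_smul, map_sum, TensorProduct.sum_tmul,
    Finset.sum_mul, mul_smul_comm, ← TensorProduct.smul_tmul', smul_mul_assoc]

/-- A semisimple Hopf algebra is finite-dimensional. -/
theorem HopfAlgebra.finiteDimensional_of_isSemisimpleRing (k H : Type*) [Field k] [Ring H]
    [HopfAlgebra k H] [IsSemisimpleRing H] : FiniteDimensional k H := by
  classical
  obtain ⟨Λ, hε, hΛ⟩ := exists_normalized_integral k H
  let b := Module.Free.chooseBasis k H
  obtain ⟨c, hc⟩ := TensorProduct.eq_repr_basis_left b (comul (R := k) Λ)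
  -- `W` is spanned by the finitely many right legs of `Δ(Λ)`. Reading off the `j`-th left
  -- coordinate of `(1 ⊗ h)Δ(Λ) = (S(h) ⊗ 1)Δ(Λ)` puts `h c_j` in `W`, and `S(Λ₁)Λ₂ = ε(Λ) = 1` then
  -- gives `W = H`.
  let W : Submodule k H := Submodule.span k (c.support.image c)
  have hcW (i) : c i ∈ W := by
    by_cases hi : c i = 0
    · rw [hi]
      exact W.zero_mem
    · exact Submodule.subset_span (Finset.mem_coe.2 (Finset.mem_image_of_mem _
        (Finsupp.mem_support_iff.2 hi)))
  let φ (i) : H ⊗[k] H →ₗ[k] H := TensorProduct.lift ((LinearMap.lsmul k H).comp (b.coord i))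
  have hφ (i) (x y : H) : φ i (x ⊗ₜ y) = b.coord i x • y := rfl
  have hmul (h : H) (j) : h * c j ∈ W := by
    have h1 := congrArg (φ j) (one_tmul_mul_comul_of_integral hΛ h)
    rw [← hc, Finsupp.sum, Finset.mul_sum, Finset.mul_sum, map_sum, map_sum] at h1
    simp only [Algebra.TensorProduct.tmul_mul_tmul, one_mul, hφ, Module.Basis.coord_apply,
      Module.Basis.repr_self] at h1
    have h2 : ∑ i ∈ c.support, (Finsupp.single i (1 : k)) j • (h * c i) = h * c j := by
      rw [Finset.sum_eq_single j]
      · simp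
      · intro i _ hi
        simp [Finsupp.single_eq_of_ne hi.symm]
      · intro hj
        simp [Finsupp.notMem_support_iff.1 hj]
    rw [h2] at h1
    rw [h1]
    exact sum_mem fun i _ => W.smul_mem _ (hcW i)
  have hone : ∑ i ∈ c.support, antipode k (b i) * c i = 1 := by
    have h1 := HopfAlgebra.mul_antipode_rTensor_comul_apply (R := k) Λ
    rw [← hc, hε, Finsupp.sum] at h1
    simpa using h1
  have htop : W = ⊤ := by
    rw [eq_top_iff]
    rintro x -
    rw [← mul_one x, ← hone, Finset.mul_sum]
    refine sum_mem fun i _ => ?_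
    rw [← mul_assoc]
    exact hmul _ i
  exact ⟨⟨c.support.image c, htop⟩⟩

end FiniteDimensional

/-! ### Splitting off simple factors -/

namespace HopfSubalgebra

variable {k : Type*} {H : Type v} [Field k] [Ring H] [HopfAlgebra k H]

/-- The join of two Hopf subalgebras. -/
def join (A B : HopfSubalgebra k H) : HopfSubalgebra k H :=
  generated fun b : Bool => cond b A B

theorem left_le_join (A B : HopfSubalgebra k H) : A.toSubalgebra ≤ (join A B).toSubalgebra :=
  le_generated (fun b : Bool => cond b A B) true

theorem right_le_join (A B : HopfSubalgebra k H) : B.toSubalgebra ≤ (join A B).toSubalgebra :=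
  le_generated (fun b : Bool => cond b A B) false

theorem join_le {A B : HopfSubalgebra k H} {S : Subalgebra k H} (hA : A.toSubalgebra ≤ S)
    (hB : B.toSubalgebra ≤ S) : (join A B).toSubalgebra ≤ S :=
  iSup_le fun b => by cases b <;> assumption

theorem IsNormal.join {A B : HopfSubalgebra k H} (hA : A.IsNormal) (hB : B.IsNormal) :
    (A.join B).IsNormal :=
  generated_isNormal _ fun b => by cases b <;> assumption

/-- A nontrivial subalgebra `A` contains a Hopf subalgebra maximal among the normal Hopf subalgebras of
`H` properly contained in `A`. -/
theorem exists_maximal_normal [FiniteDimensional k H] {A : Subalgebra k H} (hA : A ≠ ⊥) :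
    ∃ N : HopfSubalgebra k H, N.IsNormal ∧ N.toSubalgebra < A ∧
      ∀ M : HopfSubalgebra k H, M.IsNormal → N.toSubalgebra ≤ M.toSubalgebra →
        M.toSubalgebra ≤ A → M.toSubalgebra = N.toSubalgebra ∨ M.toSubalgebra = A := by
  have : WellFoundedGT (Subalgebra k H) :=
    StrictMono.wellFoundedGT (f := Subalgebra.toSubmodule) fun _ _ h => h
  let T : Set (Subalgebra k H) :=
    {S | ∃ N : HopfSubalgebra k H, N.IsNormal ∧ N.toSubalgebra = S ∧ S < A}
  have hT : T.Nonempty := by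
    refine ⟨⊥, generated (fun i : Empty => i.elim), generated_isNormal _ (fun i => i.elim), ?_,
      bot_lt_iff_ne_bot.2 hA⟩
    exact iSup_of_empty _
  obtain ⟨_, ⟨N, hN, rfl, hNA⟩, hmax⟩ :=
    (wellFounded_gt (α := Subalgebra k H)).has_min T hT
  refine ⟨N, hN, hNA, fun M hM hNM hMA => ?_⟩
  by_contra! hne
  exact hmax _ ⟨M, hM, rfl, lt_of_le_of_ne hMA hne.2⟩ (lt_of_le_of_ne hNM hne.1.symm)

/-- The subalgebra on which a homomorphism is trivial. -/
def trivialLocus (f : H →ₐc[k] H) : Subalgebra k H :=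
  AlgHom.equalizer (f : H →ₐ[k] H) ((Algebra.ofId k H).comp (Bialgebra.counitAlgHom k H))

/-- The hypothesis that each proper normal Hopf subalgebra lies in a proper direct factor. -/
def HasDirectFactors (k : Type*) (H : Type*) [Field k] [Ring H] [HopfAlgebra k H] : Prop :=
  ∀ N : HopfSubalgebra k H, N.IsNormal → N.toSubalgebra ≠ ⊤ →
    ∃ A : HopfSubalgebra k H, A.IsDirectFactor ∧ A.toSubalgebra ≠ ⊤ ∧
      N.toSubalgebra ≤ A.toSubalgebra

/-- Let `N` be a maximal normal Hopf subalgebra in a normal tensor factor `A`. If the projection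
`κ` onto a normal Hopf subalgebra of `A` kills `N`, and `A` is generated by `N` and the image of
`κ`, then this image is simple. -/
theorem isSimpleHopf_range {κ : H →ₐc[k] H} (hκ : IsAdjointEquivariant κ)
    (hidem : ∀ x, κ (κ x) = κ x) {N A : HopfSubalgebra k H} (hN : N.IsNormal)
    (hNA : N.toSubalgebra < A.toSubalgebra)
    (hmax : ∀ M : HopfSubalgebra k H, M.IsNormal → N.toSubalgebra ≤ M.toSubalgebra →
        M.toSubalgebra ≤ A.toSubalgebra → M.toSubalgebra = N.toSubalgebra ∨
          M.toSubalgebra = A.toSubalgebra)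
    (hκN : ∀ x ∈ N.toSubalgebra, κ x = algebraMap k H (counit x))
    (hκA : (range κ).toSubalgebra ≤ A.toSubalgebra)
    (hgen : A.toSubalgebra ≤ (N.join (range κ)).toSubalgebra) :
    IsSimpleHopf k (range κ).toSubalgebra := by
  constructor
  · intro h
    have hbot : (range κ).toSubalgebra ≤ ⊥ := by
      intro x hx
      have h1 : (⟨x, hx⟩ : (range κ).toSubalgebra) ∈ (⊥ : Subalgebra k _) := h ▸ trivial
      obtain ⟨r, hr⟩ := Algebra.mem_bot.1 h1
      exact Algebra.mem_bot.2 ⟨r, congrArg Subtype.val hr⟩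
    exact hNA.not_ge (hgen.trans (join_le le_rfl (hbot.trans bot_le)))
  · intro M hM
    have hcoe (x : (range κ).toSubalgebra) : κ x = x := by
      obtain ⟨y, hy⟩ := mem_range.1 x.2
      rw [← hy, hidem]
    set M' := map (range κ).incl M
    have hM'κ : M'.toSubalgebra ≤ (range κ).toSubalgebra := by
      rintro _ ⟨m, -, rfl⟩
      exact m.2
    -- An element `h` acts on the image of `κ` as `κ(h)` does, so normality inside this image gives
    -- normality in `H`.
    have hM'n : M'.IsNormal := by
      rintro h _ ⟨m, hm, rfl⟩
      change leftAdjoint k (m : H) h ∈ _ ∧ rightAdjoint k (m : H) h ∈ _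
      set g := codRestrict κ (range κ) (apply_mem_range κ)
      have h1 : leftAdjoint k (m : H) h = (range κ).incl (leftAdjoint k m (g h)) := by
        have := hκ.left m h
        rw [hcoe] at this
        rw [map_leftAdjoint]
        exact this
      have h2 : rightAdjoint k (m : H) h = (range κ).incl (rightAdjoint k m (g h)) := by
        have := hκ.right m h
        rw [hcoe] at this
        rw [map_rightAdjoint]
        exact this
      rw [h1, h2]
      exact ⟨⟨_, (hM (g h) m hm).1, rfl⟩, ⟨_, (hM (g h) m hm).2, rfl⟩⟩
    -- If the join is `N`, then `κ` is both the identity and `ε` on `M`, so `M = k`. If it is `A`,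
    -- applying `κ`, trivial on `N` and the identity on `M'`, gives `κ(A) ⊆ M'`.
    rcases hmax (N.join M') (hN.join hM'n) (left_le_join _ _)
      (join_le hNA.le (hM'κ.trans hκA)) with h | h
    · left
      rw [eq_bot_iff]
      intro m hm
      have h1 : (m : H) ∈ N.toSubalgebra := h ▸ right_le_join N M' ⟨m, hm, rfl⟩
      have h2 := hκN _ h1
      rw [hcoe] at h2
      exact Algebra.mem_bot.2 ⟨_, Subtype.ext h2.symm⟩
    · right
      rw [eq_top_iff]
      rintro x -
      have h1 : A.toSubalgebra ≤ M'.toSubalgebra.comap (κ : H →ₐ[k] H) := by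
        rw [← h]
        refine join_le (fun y hy => ?_) ?_
        · change κ y ∈ M'.toSubalgebra
          rw [hκN y hy]
          exact Subalgebra.algebraMap_mem _ _
        · rintro _ ⟨m, hm, rfl⟩
          exact ⟨m, hm, (hcoe m).symm⟩
      obtain ⟨m, hm, hmx⟩ : κ (x : H) ∈ M'.toSubalgebra := h1 (hκA x.2)
      rw [hcoe] at hmx
      rwa [← Subtype.ext hmx]

/-- A maximal normal Hopf subalgebra of a normal tensor factor `A` splits off, with a simple
complement. -/
theorem IsFactorProjection.exists_splitting (hH : HasDirectFactors k H)
    {π : H →ₐc[k] H} {L N : HopfSubalgebra k H} (hπ : IsFactorProjection π L) (hL : L.IsNormal)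
    (hN : N.IsNormal) (hNA : N.toSubalgebra < (range π).toSubalgebra)
    (hmax : ∀ M : HopfSubalgebra k H, M.IsNormal → N.toSubalgebra ≤ M.toSubalgebra →
        M.toSubalgebra ≤ (range π).toSubalgebra → M.toSubalgebra = N.toSubalgebra ∨
          M.toSubalgebra = (range π).toSubalgebra) :
    ∃ σ κ : H →ₐc[k] H, (range σ).toSubalgebra = N.toSubalgebra ∧
      (range κ).IsNormal ∧ IsSimpleHopf k (range κ).toSubalgebra ∧
      (range σ).toSubalgebra ⊔ (range κ).toSubalgebra = (range π).toSubalgebra ∧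
      IsFactorProjection σ ((range κ).join L) ∧ (∀ x, κ (κ x) = κ x) ∧
      (∀ x ∈ N.toSubalgebra, κ x = algebraMap k H (counit x)) ∧
      (∀ x ∈ L.toSubalgebra, κ x = algebraMap k H (counit x)) := by
  -- `π` maps both `N` and `L` into `N`, so equality with `H` would give `π(H) ⊆ N`.
  have hPtop : (N.join L).toSubalgebra ≠ ⊤ := by
    intro htop
    have h1 : (N.join L).toSubalgebra ≤ N.toSubalgebra.comap (π : H →ₐ[k] H) := by
      refine join_le (fun x hx => ?_) (fun x hx => ?_)
      · change π x ∈ N.toSubalgebra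
        rwa [hπ.apply_of_mem_range (hNA.le hx)]
      · change π x ∈ N.toSubalgebra
        rw [hπ.apply_of_mem x hx]
        exact Subalgebra.algebraMap_mem _ _
    refine hNA.not_ge fun x hx => ?_
    obtain ⟨y, rfl⟩ := mem_range.1 hx
    exact h1 (htop ▸ trivial)
  obtain ⟨B, ⟨-, C, -, hBC⟩, hBtop, hPB⟩ := hH _ (hN.join hL) hPtop
  have hNB := (left_le_join N L).trans hPB
  have hLB := (right_le_join N L).trans hPB
  obtain ⟨β, γ, hβ, hγ, hβB, hβb, hγC, hγc, hγb, hconv⟩ := hBC.exists_isFactorProjection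
  have hγL (x) (hx : x ∈ L.toSubalgebra) : γ x = algebraMap k H (counit x) := hγb x (hLB hx)
  have hγπ (x) : γ (π x) = γ x := hπ.comp_apply hγL x
  have hγβ (x) : γ (β x) = algebraMap k H (counit x) := by
    rw [hγb _ (hβB x), CoalgHomClass.counit_comp_apply]
  have hβγ (x) : β (γ x) = algebraMap k H (counit x) := by
    rw [hβ.apply_of_mem _ (hγC x), CoalgHomClass.counit_comp_apply]
  set σ := π.comp β
  set κ := π.comp γ
  have hσx (x) : σ x = π (β x) := rfl
  have hκx (x) : κ x = π (γ x) := rfl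
  have hσL (x) (hx : x ∈ L.toSubalgebra) : σ x = algebraMap k H (counit x) := by
    rw [hσx, hβb x (hLB hx), hπ.apply_of_mem x hx]
  have hσπ (x) : σ (π x) = σ x := hπ.comp_apply hσL x
  have hσσ (x) : σ (σ x) = σ x := by
    rw [hσx x, hσπ, hσx, hβb _ (hβB x)]
  have hκκ (x) : κ (κ x) = κ x := by
    rw [hκx, hκx x, hγπ, hγc _ (hγC x)]
  have hκN (x) (hx : x ∈ N.toSubalgebra) : κ x = algebraMap k H (counit x) := by
    rw [hκx, hγb _ (hNB hx)]
    exact AlgHomClass.commutes π _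
  have hκL (x) (hx : x ∈ L.toSubalgebra) : κ x = algebraMap k H (counit x) := by
    rw [hκx, hγb _ (hLB hx)]
    exact AlgHomClass.commutes π _
  have hσe : IsAdjointEquivariant σ := hπ.equivariant.comp hβ.equivariant
  have hκe : IsAdjointEquivariant κ := hπ.equivariant.comp hγ
  have hσA : (range σ).toSubalgebra ≤ (range π).toSubalgebra := by
    rintro _ ⟨x, -, rfl⟩
    exact apply_mem_range π (β x)
  have hκA : (range κ).toSubalgebra ≤ (range π).toSubalgebra := by
    rintro _ ⟨x, -, rfl⟩
    exact apply_mem_range π (γ x)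
  have hNσ : N.toSubalgebra ≤ (range σ).toSubalgebra := by
    intro x hx
    refine mem_range.2 ⟨x, ?_⟩
    rw [hσx, hβb x (hNB hx), hπ.apply_of_mem_range (hNA.le hx)]
  have hσN : (range σ).toSubalgebra = N.toSubalgebra := by
    -- If `σ(H) = π(H)`, every `πx` is some `πβy`; since `γπ = γ` and `γβ = ε`, this makes `γ`
    -- trivial. Then `β = id * Sγ = id` and `B = H`.
    refine (hmax (range σ) hσe.range_isNormal hNσ hσA).resolve_right fun h => hBtop ?_
    have hγ1 (x) : γ x = algebraMap k H (counit x) := by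
      have h1 : π x ∈ (range σ).toSubalgebra := h ▸ apply_mem_range π x
      obtain ⟨y, hy⟩ := mem_range.1 h1
      rw [← hγπ, ← hy, hσx, hγπ, hγβ, ← CoalgHomClass.counit_comp_apply σ y, hy,
        CoalgHomClass.counit_comp_apply]
    have h2 : toConv (antipode k ∘ₗ (γ : H →ₐ[k] H).toLinearMap) = 1 := by
      ext x
      refine (congrArg (antipode k) (hγ1 x)).trans ?_
      simp [Algebra.algebraMap_eq_smul_one]
    rw [h2, mul_one] at hconv
    rw [eq_top_iff]
    rintro x -
    have h3 : β x = x := LinearMap.congr_fun (congrArg ofConv hconv) x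
    exact h3 ▸ hβB x
  -- This is `π` applied to `β = id * Sγ`. It yields both `π = σ * κ` and `σ = id * (θ * Sκ)`, the
  -- latter with second factor valued in the new complement.
  have hconvσ : toConv (σ : H →ₐ[k] H).toLinearMap =
      toConv (π : H →ₐ[k] H).toLinearMap *
        toConv (antipode k ∘ₗ (κ : H →ₐ[k] H).toLinearMap) := by
    have h1 := comp_conv π LinearMap.id (antipode k ∘ₗ (γ : H →ₐ[k] H).toLinearMap)
    rw [← hconv] at h1
    refine h1.trans ?_
    congr 2
    ext x
    exact BialgHom.map_antipode π (γ x)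
  have hgen : (range π).toSubalgebra ≤ (N.join (range κ)).toSubalgebra := by
    have hSκ : toConv (antipode k ∘ₗ (κ : H →ₐ[k] H).toLinearMap) *
        toConv (κ : H →ₐ[k] H).toLinearMap = 1 := by
      have h1 := LinearMap.convMul_comp_coalgHom_distrib (toConv (antipode k (A := H)))
        (toConv LinearMap.id) (κ : H →ₗc[k] H)
      rw [LinearMap.antipode_mul_id] at h1
      apply WithConv.ext
      refine h1.symm.trans ?_
      ext x
      simp
    have h2 : toConv (π : H →ₐ[k] H).toLinearMap =
        toConv (σ : H →ₐ[k] H).toLinearMap * toConv (κ : H →ₐ[k] H).toLinearMap := by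
      rw [hconvσ, mul_assoc, hSκ, mul_one]
    rintro _ ⟨x, -, rfl⟩
    have h3 := convMul_mem_of_forall (E := (N.join (range κ)).toSubalgebra)
      (f := (σ : H →ₐ[k] H).toLinearMap) (g := (κ : H →ₐ[k] H).toLinearMap)
      (fun y => left_le_join _ _ (hσN ▸ apply_mem_range σ y))
      (fun y => right_le_join _ _ (apply_mem_range κ y)) x
    rw [← h2] at h3
    exact h3
  refine ⟨σ, κ, hσN, hκe.range_isNormal,
    isSimpleHopf_range hκe hκκ hN hNA hmax hκN hκA hgen, ?_, ⟨hσe, hσσ, ?_, ?_⟩, hκκ, hκN, hκL⟩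
  · refine le_antisymm (sup_le hσA hκA) (hgen.trans (join_le ?_ le_sup_right))
    rw [hσN]
    exact le_sup_left
  · refine join_le (S := trivialLocus σ) ?_ hσL
    rintro _ ⟨x, -, rfl⟩
    change σ (κ x) = algebraMap k H (counit (κ x))
    rw [hκx, hσπ, hσx, hβγ, CoalgHomClass.counit_comp_apply, CoalgHomClass.counit_comp_apply]
    exact AlgHomClass.commutes π _
  · obtain ⟨θ, hθ, h⟩ := hπ.exists_conv
    refine ⟨(toConv θ * toConv (antipode k ∘ₗ (κ : H →ₐ[k] H).toLinearMap)).ofConv,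
      fun x => convMul_mem_of_forall (fun y => right_le_join _ _ (hθ y))
        (fun y => left_le_join _ _ ((range κ).antipode_mem' (κ y) (apply_mem_range κ y))) x, ?_⟩
    rw [hconvσ, h, mul_assoc]

/-- The range of a factor projection is generated by an independent family of simple normal Hopf
subalgebras, independence being witnessed by homomorphisms `H → H`. -/
theorem IsFactorProjection.exists_family [FiniteDimensional k H] [IsSemisimpleRing H]
    (hH : HasDirectFactors k H) (π : H →ₐc[k] H) (L : HopfSubalgebra k H)
    (hπ : IsFactorProjection π L) (hL : L.IsNormal) :
    ∃ (ι : Type v) (K : ι → HopfSubalgebra k H),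
      (⨆ i, (K i).toSubalgebra) = (range π).toSubalgebra ∧
      ∀ i, (K i).IsNormal ∧ IsSimpleHopf k (K i).toSubalgebra ∧
        IsSemisimpleRing (K i).toSubalgebra ∧
        ∃ e : H →ₐ[k] H, (∀ x ∈ (K i).toSubalgebra, e x = x) ∧
          (∀ j, j ≠ i → ∀ x ∈ (K j).toSubalgebra, e x ∈ (⊥ : Subalgebra k H)) ∧
          ∀ x ∈ L.toSubalgebra, e x ∈ (⊥ : Subalgebra k H) := by
  induction hn : Module.finrank k (range π).toSubalgebra using Nat.strong_induction_on
    generalizing π L with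
  | _ n ih =>
  by_cases hbot : (range π).toSubalgebra = ⊥
  · exact ⟨PEmpty, fun i => i.elim, by rw [hbot]; exact iSup_of_empty _, fun i => i.elim⟩
  obtain ⟨N, hN, hNA, hmax⟩ := exists_maximal_normal hbot
  obtain ⟨σ, κ, hσN, hκn, hκs, hsup, hσ, hκκ, hκN, hκL⟩ :=
    hπ.exists_splitting hH hL hN hNA hmax
  have hlt : Module.finrank k (range σ).toSubalgebra < n := by
    rw [← hn, hσN]
    exact Submodule.finrank_lt_finrank_of_lt (s := Subalgebra.toSubmodule N.toSubalgebra)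
      (t := Subalgebra.toSubmodule (range π).toSubalgebra) hNA
  obtain ⟨ι, K, hK, hKi⟩ := ih _ hlt σ _ hσ (hκn.join hL) rfl
  have hKN (i) : (K i).toSubalgebra ≤ N.toSubalgebra :=
    hσN ▸ hK ▸ le_iSup (fun i => (K i).toSubalgebra) i
  -- The family for `N` is enlarged by `κ(H)`, whose witness is `κ` itself: it is trivial on `N`,
  -- hence on every `K j`, and on `L`.
  refine ⟨Option ι, fun o => o.elim (range κ) K, ?_, ?_⟩
  · rw [iSup_option]
    simp only [Option.elim]
    rw [hK, sup_comm, hsup]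
  · rintro (_ | i)
    · refine ⟨hκn, hκs, ?_, (κ : H →ₐ[k] H), ?_, ?_, ?_⟩
      · exact RingHom.isSemisimpleRing_of_surjective
          ((κ : H →ₐ[k] H).codRestrict (range κ).toSubalgebra (apply_mem_range κ)).toRingHom
          fun ⟨x, hx⟩ => by
            obtain ⟨y, hy⟩ := mem_range.1 hx
            exact ⟨y, Subtype.ext hy⟩
      · intro x hx
        obtain ⟨y, rfl⟩ := mem_range.1 hx
        exact hκκ y
      · rintro (_ | j) hj x hx
        · exact absurd rfl hj
        · exact Algebra.mem_bot.2 ⟨_, (hκN x (hKN j hx)).symm⟩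
      · exact fun x hx => Algebra.mem_bot.2 ⟨_, (hκL x hx).symm⟩
    · obtain ⟨h1, h2, h3, e, he1, he2, he3⟩ := hKi i
      refine ⟨h1, h2, h3, e, he1, ?_, fun x hx => he3 x (right_le_join _ _ hx)⟩
      rintro (_ | j) hj x hx
      -- The old witness is scalar-valued on the complement of `N`, which contains `κ(H)`; this is
      -- why the induction keeps track of `L`.
      · exact he3 x (left_le_join _ _ hx)
      · exact he2 j (fun h => hj (h ▸ rfl)) x hx

end HopfSubalgebra

end CompleteReducibility

theorem theorem4p8 (k : Type*) (H : Type*) [Field k] [IsAlgClosed k] [CharZero k]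
    [Ring H] [HopfAlgebra k H] [IsSemisimpleRing H]
    (hH : ∀ N : HopfSubalgebra k H, N.IsNormal → N.toSubalgebra ≠ ⊤ →
      ∃ A : HopfSubalgebra k H, A.IsDirectFactor ∧ A.toSubalgebra ≠ ⊤ ∧
        N.toSubalgebra ≤ A.toSubalgebra) :
    IsCompletelyReducibleHopf k H := by
  have := HopfAlgebra.finiteDimensional_of_isSemisimpleRing k H
  have hbot : (HopfSubalgebra.generated fun i : Empty =>
      (i.elim : HopfSubalgebra k H)).toSubalgebra = ⊥ := iSup_of_empty _
  obtain ⟨ι, K, hK, hKi⟩ := HopfSubalgebra.IsFactorProjection.exists_family hH (BialgHom.id k H) _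
    (HopfSubalgebra.isFactorProjection_id _ hbot)
    (HopfSubalgebra.generated_isNormal _ fun i => i.elim)
  refine ⟨ι, K, ⟨fun i => (hKi i).1, hK.trans ?_, fun i => ?_⟩,
    fun i => ⟨(hKi i).2.1, (hKi i).2.2.1⟩⟩
  · exact eq_top_iff.2 fun x _ => HopfSubalgebra.mem_range.2 ⟨x, rfl⟩
  · obtain ⟨-, -, -, e, he1, he2, -⟩ := hKi i
    rw [eq_bot_iff]
    rintro x ⟨hx, hx'⟩
    -- The witness `e` sends everything generated by the other members to scalars but fixes `K i`,
    -- so a common element is a scalar.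
    have h1 : (HopfSubalgebra.generated fun j : {j : ι // j ≠ i} => K j).toSubalgebra ≤
        (⊥ : Subalgebra k H).comap e := iSup_le fun j x hx => he2 j j.2 x hx
    have h2 : e x ∈ (⊥ : Subalgebra k H) := h1 hx'
    rwa [he1 x hx] at h2
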